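/- Let $H$ be a real or complex Hilbert space (of arbitrary dimension, not necessarily separable) with scalar field $\mathbb K$. For $\xi,\eta\in H$ write $\xi\otimes\eta$ for the rank one operator $x\mapsto\langle x,\eta\rangle\,\xi$ (here $\langle\cdot,\cdot\rangle$ is linear in the first variable). Let $L^1(H)=H\otimes_\pi H$ be the space of trace class operators on $H$, that is, of all operators $u=\sum_{n}\xi_n\otimes\eta_n$ with $\xi_n,\eta_n\in H$ and $\sum_n\|\xi_n\|\,\|\eta_n\|<\infty$, with the norm $$\|u\|_\pi=\inf\Big\{\sum_n\|\xi_n\|\,\|\eta_n\| : u=\sum_n\xi_n\otimes\eta_n\Big\},$$ and let $K(H)$ be the space of compact operators on $H$ with the operator norm. Then $L^1(H)$ is the dual of $K(H)$, that is, $u\mapsto\big(T\mapsto \operatorname{tr}(uT)\big)$ is an isometric linear isomorphism of $L^1(H)$ onto $K(H)^*$, and $L^1(H)$, with the weak$^*$ topology given by this identification, has the UKK$^*$ property: for every $\varepsilon>0$ there is $\delta\in(0,1)$ such that, whenever $C$ is a weak$^*$ compact convex subset of the closed unit ball of $L^1(H)$ with $$\sup\Big\{\inf_{n\neq m}\|x_n-x_m\|_\pi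 : (x_n)_{n\in\mathbb N}\subset C\Big\}\ge\varepsilon,$$ the set $C$ contains an element $x$ with $\|x\|_\pi\le 1-\delta$. -/

import Mathlib

open InnerProductSpace

universe u v w

/-! ### Trace class operators, with the projective (nuclear) norm -/

section TraceClass

variable (𝕜 : Type v) (H : Type u) [RCLike 𝕜] [NormedAddCommGroup H] [InnerProductSpace 𝕜 H]

variable {𝕜 H} in
/-- `IsNuclearRep T ξ η` says that `T = ∑ₙ ξₙ ⊗ ηₙ` with `∑ₙ ‖ξₙ‖ ‖ηₙ‖ < ∞`, where `ξ ⊗ η` is the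
rank one operator `x ↦ ⟨η, x⟩ ξ` and the series of operators converges in the operator norm. -/
def IsNuclearRep (T : H →L[𝕜] H) (ξ η : ℕ → H) : Prop :=
  Summable (fun n => ‖ξ n‖ * ‖η n‖) ∧ HasSum (fun n => rankOne 𝕜 (ξ n) (η n)) T

variable {𝕜 H} in
/-- The set of the values `∑ₙ ‖ξₙ‖ ‖ηₙ‖` over all representations `T = ∑ₙ ξₙ ⊗ ηₙ`. -/
def nuclearValues (T : H →L[𝕜] H) : Set ℝ :=
  {c | ∃ ξ η : ℕ → H, IsNuclearRep T ξ η ∧ c = ∑' n, ‖ξ n‖ * ‖η n‖}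

variable {𝕜 H} in
/-- The projective norm `‖T‖_π = inf {∑ₙ ‖ξₙ‖ ‖ηₙ‖ : T = ∑ₙ ξₙ ⊗ ηₙ}`. -/
noncomputable def projNorm (T : H →L[𝕜] H) : ℝ := sInf (nuclearValues T)

variable {𝕜 H}

theorem nuclearValues_nonneg {T : H →L[𝕜] H} {c : ℝ} (hc : c ∈ nuclearValues T) : 0 ≤ c := by
  obtain ⟨ξ, η, -, rfl⟩ := hc
  exact tsum_nonneg fun n => by positivity

theorem projNorm_nonneg (T : H →L[𝕜] H) : 0 ≤ projNorm T :=
  Real.sInf_nonneg fun _ => nuclearValues_nonneg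

theorem projNorm_le {T : H →L[𝕜] H} {c : ℝ} (hc : c ∈ nuclearValues T) : projNorm T ≤ c :=
  csInf_le ⟨0, fun _ => nuclearValues_nonneg⟩ hc

theorem nuclearValues_zero : (0 : ℝ) ∈ nuclearValues (0 : H →L[𝕜] H) :=
  ⟨0, 0, ⟨by simp [summable_zero], by simp [hasSum_zero]⟩, by simp⟩

theorem nuclearValues_add {S T : H →L[𝕜] H} {c d : ℝ} (hc : c ∈ nuclearValues S)
    (hd : d ∈ nuclearValues T) : c + d ∈ nuclearValues (S + T) := by
  obtain ⟨ξ, η, ⟨h1, h2⟩, rfl⟩ := hc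
  obtain ⟨ξ', η', ⟨h1', h2'⟩, rfl⟩ := hd
  have e := Equiv.natSumNatEquivNat
  have A : HasSum (fun k : ℕ ⊕ ℕ => ‖Sum.elim ξ ξ' k‖ * ‖Sum.elim η η' k‖)
      ((∑' n, ‖ξ n‖ * ‖η n‖) + ∑' n, ‖ξ' n‖ * ‖η' n‖) :=
    HasSum.sum h1.hasSum h1'.hasSum
  have B : HasSum (fun k : ℕ ⊕ ℕ => rankOne 𝕜 (Sum.elim ξ ξ' k) (Sum.elim η η' k)) (S + T) :=
    HasSum.sum h2 h2'
  have A' := (Equiv.hasSum_iff e.symm).2 A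
  have B' := (Equiv.hasSum_iff e.symm).2 B
  exact ⟨Sum.elim ξ ξ' ∘ e.symm, Sum.elim η η' ∘ e.symm, ⟨A'.summable, B'⟩, A'.tsum_eq.symm⟩

theorem nuclearValues_smul (a : 𝕜) {T : H →L[𝕜] H} {c : ℝ} (hc : c ∈ nuclearValues T) :
    ‖a‖ * c ∈ nuclearValues (a • T) := by
  obtain ⟨ξ, η, ⟨h1, h2⟩, rfl⟩ := hc
  refine ⟨fun n => a • ξ n, η, ⟨?_, ?_⟩, ?_⟩
  · simpa [norm_smul, mul_assoc] using h1.mul_left ‖a‖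
  · simpa using h2.const_smul a
  · simp [norm_smul, mul_assoc, tsum_mul_left]

theorem opNorm_le_of_mem_nuclearValues {T : H →L[𝕜] H} {c : ℝ} (hc : c ∈ nuclearValues T) :
    ‖T‖ ≤ c := by
  obtain ⟨ξ, η, ⟨h1, h2⟩, rfl⟩ := hc
  rw [← h2.tsum_eq]
  exact tsum_of_norm_bounded h1.hasSum fun n => by simp

variable (𝕜 H)

/-- The subspace of `B(H)` of all operators `∑ₙ ξₙ ⊗ ηₙ` with `∑ₙ ‖ξₙ‖ ‖ηₙ‖ < ∞`. -/
def traceClassSubmodule : Submodule 𝕜 (H →L[𝕜] H) where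
  carrier := {T | (nuclearValues T).Nonempty}
  add_mem' := fun ⟨_, hc⟩ ⟨_, hd⟩ => ⟨_, nuclearValues_add hc hd⟩
  zero_mem' := ⟨_, nuclearValues_zero⟩
  smul_mem' := fun a _ ⟨_, hc⟩ => ⟨_, nuclearValues_smul a hc⟩

/-- The space `L¹(H) = H ⊗_π H` of trace class operators on `H`. It is a type of its own because its
norm is the projective norm and not the operator norm. -/
def TraceClass : Type u := traceClassSubmodule 𝕜 H

namespace TraceClass

noncomputable instance : AddCommGroup (TraceClass 𝕜 H) :=
  inferInstanceAs (AddCommGroup (traceClassSubmodule 𝕜 H))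

noncomputable instance : Module 𝕜 (TraceClass 𝕜 H) :=
  inferInstanceAs (Module 𝕜 (traceClassSubmodule 𝕜 H))

/-- The inclusion of `L¹(H)` into `B(H)`. -/
def toOp : TraceClass 𝕜 H →ₗ[𝕜] (H →L[𝕜] H) := (traceClassSubmodule 𝕜 H).subtype

variable {𝕜 H}

theorem toOp_injective : Function.Injective (toOp 𝕜 H) := Subtype.val_injective

theorem nonempty_nuclearValues (T : TraceClass 𝕜 H) : (nuclearValues (toOp 𝕜 H T)).Nonempty := T.2

noncomputable instance : Norm (TraceClass 𝕜 H) := ⟨fun T => projNorm (toOp 𝕜 H T)⟩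

theorem norm_def (T : TraceClass 𝕜 H) : ‖T‖ = projNorm (toOp 𝕜 H T) := rfl

theorem norm_smul_le' (a : 𝕜) (T : TraceClass 𝕜 H) : ‖a • T‖ ≤ ‖a‖ * ‖T‖ := by
  rw [norm_def, norm_def, map_smul]
  have : projNorm (a • toOp 𝕜 H T) ∈ lowerBounds ((fun c => ‖a‖ * c) '' nuclearValues (toOp 𝕜 H T)) := by
    rintro _ ⟨c, hc, rfl⟩
    exact projNorm_le (nuclearValues_smul a hc)
  have h := le_csInf (T.nonempty_nuclearValues.image _) this
  rwa [← smul_eq_mul, projNorm.eq_def (toOp 𝕜 H T), ← Real.sInf_smul_of_nonneg (norm_nonneg a)]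

theorem core : NormedSpace.Core 𝕜 (TraceClass 𝕜 H) where
  norm_nonneg T := projNorm_nonneg _
  norm_smul a T := by
    refine le_antisymm (norm_smul_le' a T) ?_
    rcases eq_or_ne a 0 with rfl | ha
    · rw [norm_zero, zero_mul]
      exact projNorm_nonneg _
    · have h := norm_smul_le' a⁻¹ (a • T)
      rw [smul_smul, inv_mul_cancel₀ ha, one_smul, norm_inv] at h
      have ha' : 0 < ‖a‖ := norm_pos_iff.2 ha
      calc ‖a‖ * ‖T‖ ≤ ‖a‖ * (‖a‖⁻¹ * ‖a • T‖) := by gcongr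
        _ = ‖a • T‖ := by rw [← mul_assoc, mul_inv_cancel₀ ha'.ne', one_mul]
  norm_triangle S T := by
    rw [norm_def, norm_def, norm_def, map_add]
    refine le_of_forall_pos_lt_add fun ε hε => ?_
    obtain ⟨c, hc, hc'⟩ := Real.lt_sInf_add_pos S.nonempty_nuclearValues (half_pos hε)
    obtain ⟨d, hd, hd'⟩ := Real.lt_sInf_add_pos T.nonempty_nuclearValues (half_pos hε)
    have := projNorm_le (nuclearValues_add hc hd)
    simp only [projNorm] at *
    linarith
  norm_eq_zero_iff T := by
    constructor
    · intro h
      have h1 : ‖toOp 𝕜 H T‖ ≤ 0 := h ▸ le_csInf T.nonempty_nuclearValues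
        fun c hc => opNorm_le_of_mem_nuclearValues hc
      exact toOp_injective (by rw [map_zero]; exact norm_le_zero_iff.1 h1)
    · rintro rfl
      refine le_antisymm ?_ (projNorm_nonneg _)
      rw [norm_def, map_zero]
      exact projNorm_le nuclearValues_zero

noncomputable instance : NormedAddCommGroup (TraceClass 𝕜 H) :=
  NormedAddCommGroup.ofCore (𝕜 := 𝕜) core

noncomputable instance : NormedSpace 𝕜 (TraceClass 𝕜 H) := NormedSpace.ofCore core

end TraceClass

end TraceClass

/-! ### The uniform Kadec-Klee property in the weak* topology -/

section UKK

/-- `sep (xₙ) = inf {‖xₙ - xₘ‖ : n ≠ m}`. -/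
noncomputable def sep {X : Type w} [NormedAddCommGroup X] (x : ℕ → X) : ℝ :=
  sInf {d | ∃ n m, n ≠ m ∧ d = ‖x n - x m‖}

variable {𝕜 : Type v} {X : Type w} {Y : Type u} [RCLike 𝕜] [NormedAddCommGroup X] [NormedSpace 𝕜 X]
  [NormedAddCommGroup Y] [NormedSpace 𝕜 Y]

/-- Compactness of a subset of `X` in the weak* topology, where `X` is regarded as the dual of `Y`
through `Φ`. -/
def IsWeakStarCompact (Φ : X ≃ₗᵢ[𝕜] StrongDual 𝕜 Y) (C : Set X) : Prop :=
  IsCompact ((fun x => StrongDual.toWeakDual (Φ x)) '' C)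

/-- The `ε`-UKK* property of `X`, regarded as the dual of `Y` through `Φ`. -/
def EpsUKKStar (Φ : X ≃ₗᵢ[𝕜] StrongDual 𝕜 Y) (ε : ℝ) : Prop :=
  letI : NormedSpace ℝ X := NormedSpace.restrictScalars ℝ 𝕜 X
  ∃ δ ∈ Set.Ioo (0 : ℝ) 1, ∀ C : Set X, IsWeakStarCompact Φ C → Convex ℝ C →
    C ⊆ Metric.closedBall 0 1 → ε ≤ sSup {s | ∃ x : ℕ → X, (∀ n, x n ∈ C) ∧ s = sep x} →
    (C ∩ Metric.closedBall 0 (1 - δ)).Nonempty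

/-- The uniform Kadec-Klee property in the weak* topology of `X`, regarded as the dual of `Y`
through `Φ`. -/
def UKKStar (Φ : X ≃ₗᵢ[𝕜] StrongDual 𝕜 Y) : Prop := ∀ ε > 0, EpsUKKStar Φ ε

end UKK

/-! ### Compact operators and trace duality -/

section TraceDuality

variable (𝕜 : Type v) (H : Type u) [RCLike 𝕜] [NormedAddCommGroup H] [InnerProductSpace 𝕜 H]

/-- The space `K(H)` of compact operators on `H`, with the operator norm. -/
def CompactOps : Type u := (compactOperator (RingHom.id 𝕜) H H : Submodule 𝕜 (H →L[𝕜] H))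

namespace CompactOps

noncomputable instance : NormedAddCommGroup (CompactOps 𝕜 H) :=
  inferInstanceAs (NormedAddCommGroup (compactOperator (RingHom.id 𝕜) H H))

noncomputable instance : NormedSpace 𝕜 (CompactOps 𝕜 H) :=
  inferInstanceAs (NormedSpace 𝕜 (compactOperator (RingHom.id 𝕜) H H))

/-- The inclusion of `K(H)` into `B(H)`. -/
def toOp : CompactOps 𝕜 H →ₗ[𝕜] (H →L[𝕜] H) := (compactOperator (RingHom.id 𝕜) H H).subtype

variable {𝕜 H}

theorem norm_toOp (K : CompactOps 𝕜 H) : ‖toOp 𝕜 H K‖ = ‖K‖ := rfl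

end CompactOps

variable {𝕜 H}

/-- `IsTraceDuality Φ` says that the identification `Φ` of `L¹(H)` with the dual of `K(H)` is given
by trace duality: `Φ u K = tr (u K) = ∑ᵢ ⟨bᵢ, u K bᵢ⟩` for every orthonormal basis `b` of `H`. -/
def IsTraceDuality (Φ : TraceClass 𝕜 H ≃ₗᵢ[𝕜] StrongDual 𝕜 (CompactOps 𝕜 H)) : Prop :=
  ∀ (u : TraceClass 𝕜 H) (K : CompactOps 𝕜 H) (ι : Type u) (b : HilbertBasis ι 𝕜 H),
    HasSum (fun i => inner 𝕜 (b i) (TraceClass.toOp 𝕜 H u (CompactOps.toOp 𝕜 H K (b i)))) (Φ u K)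

end TraceDuality

/-! ### Rank one operators and two-sided multiplication on `K(H)`. -/

namespace CompactOps

variable {𝕜 : Type v} {H : Type u} [RCLike 𝕜] [NormedAddCommGroup H] [InnerProductSpace 𝕜 H]

/-! Duality. A functional `φ` on `K(H)` determines an operator `T` through its values on rank one
operators. Testing `φ` on finite sums of these shows that `T` is Hilbert-Schmidt, hence compact. In
an eigenbasis `b` of `T*T` the vectors `T bᵢ` are orthogonal, and testing `φ` on partial isometries
gives `∑ ‖T bᵢ‖ ≤ ‖φ‖`. As `T = ∑ T bᵢ ⊗ bᵢ`, this bounds the projective norm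
(`exists_mem_nuclearValues_le`). Surjectivity follows by density of the finite rank operators.

UKK*. For an orthogonal projection `P` let `φ_P = φ(P · P)`. Then `‖φ_P‖² + ‖φ - φ_P‖² / 2 ≤ ‖φ‖²`
(`norm_compression_sq_add_le`), by duality from estimates for operators split along `P` and `1 - P`.
Let `ψ` be a weak* cluster point of a separated sequence in the unit ball. Choose `P` of finite rank
with `ψ_P` close to `ψ`. Frequently `(φ n)_P` is norm close to `ψ_P`, since only finitely many
matrix entries matter. Two such terms are far apart, so one of them has a large remainder `φ n - (φ
n)_P`. The estimate then makes `(φ n)_P`, and with it `ψ`, uniformly shorter than 1. Weak*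
compactness puts a cluster point in `C`. -/

theorem toOp_injective : Function.Injective (toOp 𝕜 H) := Subtype.val_injective

theorem isCompactOperator_toOp (K : CompactOps 𝕜 H) : IsCompactOperator (toOp 𝕜 H K) := K.2

/-- A compact operator as an element of `K(H)`. -/
def mk (T : H →L[𝕜] H) (hT : IsCompactOperator T) : CompactOps 𝕜 H := ⟨T, hT⟩

theorem isCompactOperator_rankOne (x y : H) : IsCompactOperator (InnerProductSpace.rankOne 𝕜 x y) :=
  IsCompactOperator.clm_comp (f := innerSL 𝕜 y)
    (isCompactOperator_of_locallyCompactSpace_dom (innerSL 𝕜 y))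
    (ContinuousLinearMap.toSpanSingleton 𝕜 x)

/-- The rank one operator `z ↦ ⟨y, z⟩ x` as an element of `K(H)`. -/
noncomputable def rankOne (𝕜 : Type v) {H : Type u} [RCLike 𝕜] [NormedAddCommGroup H]
    [InnerProductSpace 𝕜 H] (x y : H) : CompactOps 𝕜 H :=
  mk (InnerProductSpace.rankOne 𝕜 x y) (isCompactOperator_rankOne x y)

@[simp]
theorem toOp_rankOne (x y : H) : toOp 𝕜 H (rankOne 𝕜 x y) = InnerProductSpace.rankOne 𝕜 x y := rfl

theorem norm_rankOne (x y : H) : ‖rankOne 𝕜 x y‖ = ‖x‖ * ‖y‖ := by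
  rw [← norm_toOp, toOp_rankOne, InnerProductSpace.norm_rankOne]

/-- The map `K ↦ A K B` on `K(H)`. -/
noncomputable def sandwich (A B : H →L[𝕜] H) : CompactOps 𝕜 H →L[𝕜] CompactOps 𝕜 H :=
  LinearMap.mkContinuous
    { toFun := fun K => mk (A ∘L toOp 𝕜 H K ∘L B)
        ((K.isCompactOperator_toOp.comp_clm B).clm_comp A)
      map_add' := fun K L => toOp_injective (by ext x; exact map_add A _ _)
      map_smul' := fun c K => toOp_injective (by ext x; exact map_smul A _ _) }
    (‖A‖ * ‖B‖) fun K => by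
      rw [← norm_toOp, ← norm_toOp K]
      calc ‖A ∘L toOp 𝕜 H K ∘L B‖ ≤ ‖A‖ * (‖toOp 𝕜 H K‖ * ‖B‖) :=
            (ContinuousLinearMap.opNorm_comp_le _ _).trans
              (by gcongr; exact ContinuousLinearMap.opNorm_comp_le _ _)
        _ = ‖A‖ * ‖B‖ * ‖toOp 𝕜 H K‖ := by ring

@[simp]
theorem toOp_sandwich (A B : H →L[𝕜] H) (K : CompactOps 𝕜 H) :
    toOp 𝕜 H (sandwich A B K) = A ∘L toOp 𝕜 H K ∘L B := rfl

end CompactOps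

/-! ### Nuclear representations and the trace. -/

section Trace

variable {𝕜 : Type v} {H : Type u} [RCLike 𝕜] [NormedAddCommGroup H] [InnerProductSpace 𝕜 H]

/-- Absolutely convergent series of rank one operators over an arbitrary index type are nuclear
representations. -/
theorem tsum_mem_nuclearValues {ι : Type*} {T : H →L[𝕜] H} {ξ η : ι → H}
    (h : Summable fun i => ‖ξ i‖ * ‖η i‖) (hT : HasSum (fun i => rankOne 𝕜 (ξ i) (η i)) T) :
    ∑' i, ‖ξ i‖ * ‖η i‖ ∈ nuclearValues T := by
  -- A summable family has countable support, which is injected into `ℕ`; the vectors are extended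
  -- by zero.
  set s : Set ι := Function.support fun i => ‖ξ i‖ * ‖η i‖ with hs
  have hc : Countable s := h.countable_support.to_subtype
  obtain ⟨f, hf⟩ := exists_injective_nat s
  have hT' : HasSum (fun i : s => rankOne 𝕜 (ξ i) (η i)) T := by
    refine (hasSum_subtype_iff_of_support_subset (f := fun i => rankOne 𝕜 (ξ i) (η i)) ?_).2 hT
    intro i hi
    simpa [hs] using hi
  have hn : HasSum (fun i : s => ‖ξ i‖ * ‖η i‖) (∑' i, ‖ξ i‖ * ‖η i‖) :=
    (hasSum_subtype_iff_of_support_subset (f := fun i => ‖ξ i‖ * ‖η i‖) subset_rfl).2 h.hasSum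
  set ξ' : ℕ → H := Function.extend f (fun i : s => ξ i) 0
  set η' : ℕ → H := Function.extend f (fun i : s => η i) 0
  have e1 : ∀ i : s, ξ' (f i) = ξ i := fun i => hf.extend_apply _ _ i
  have e2 : ∀ i : s, η' (f i) = η i := fun i => hf.extend_apply _ _ i
  have e3 : ∀ n, n ∉ Set.range f → ξ' n = 0 := fun n hn => Function.extend_apply' _ _ _ hn
  have hn' : HasSum (fun n => ‖ξ' n‖ * ‖η' n‖) (∑' i, ‖ξ i‖ * ‖η i‖) := by
    refine (hf.hasSum_iff fun n hn => by simp [e3 n hn]).1 ?_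
    simpa [Function.comp_def, e1, e2] using hn
  have hT'' : HasSum (fun n => rankOne 𝕜 (ξ' n) (η' n)) T := by
    refine (hf.hasSum_iff fun n hn => by simp [e3 n hn]).1 ?_
    simpa [Function.comp_def, e1, e2] using hT'
  exact ⟨ξ', η', ⟨hn'.summable, hT''⟩, hn'.tsum_eq.symm⟩

theorem norm_inner_apply_le (K : H →L[𝕜] H) (x y : H) :
    ‖inner 𝕜 y (K x)‖ ≤ ‖K‖ * (‖x‖ * ‖y‖) := by
  calc ‖inner 𝕜 y (K x)‖ ≤ ‖y‖ * ‖K x‖ := norm_inner_le_norm _ _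
    _ ≤ ‖y‖ * (‖K‖ * ‖x‖) := by gcongr; exact K.le_opNorm x
    _ = _ := by ring

theorem summable_inner_apply {ξ η : ℕ → H} (h : Summable fun n => ‖ξ n‖ * ‖η n‖) (K : H →L[𝕜] H) :
    Summable fun n => inner 𝕜 (η n) (K (ξ n)) :=
  .of_norm_bounded (h.mul_left ‖K‖) fun n => norm_inner_apply_le K (ξ n) (η n)

theorem norm_sum_smul_sq {ι : Type*} {e : ι → H} (he : Orthonormal 𝕜 e) (F : Finset ι)
    (c : ι → 𝕜) : ‖∑ i ∈ F, c i • e i‖ ^ 2 = ∑ i ∈ F, ‖c i‖ ^ 2 := by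
  simpa using he.orthogonalFamily.norm_sum c F

theorem norm_sum_inner_smul_le {ι : Type*} {e : ι → H} (he : Orthonormal 𝕜 e) (F : Finset ι)
    (x : H) : ‖∑ i ∈ F, inner 𝕜 (e i) x • e i‖ ≤ ‖x‖ := by
  refine le_of_sq_le_sq ?_ (norm_nonneg x)
  rw [norm_sum_smul_sq he]
  exact he.sum_inner_products_le x

/-- The trace formula `tr (T K) = ∑ₙ ⟨ηₙ, K ξₙ⟩` for `T = ∑ₙ ξₙ ⊗ ηₙ`. -/
theorem IsNuclearRep.hasSum_trace {T : H →L[𝕜] H} {ξ η : ℕ → H} (h : IsNuclearRep T ξ η)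
    (K : H →L[𝕜] H) {ι : Type*} (b : HilbertBasis ι 𝕜 H) :
    HasSum (fun i => inner 𝕜 (b i) (T (K (b i)))) (∑' n, inner 𝕜 (η n) (K (ξ n))) := by
  -- A partial trace over `F` amounts to projecting each `ξ n` onto the span of `b i`, `i ∈ F`.
  -- Projections are contractive, so dominated convergence applies.
  have key : ∀ F : Finset ι, ∑ i ∈ F, inner 𝕜 (b i) (T (K (b i)))
      = ∑' n, inner 𝕜 (η n) (K (∑ i ∈ F, inner 𝕜 (b i) (ξ n) • b i)) := by
    intro F
    have h1 : ∀ i ∈ F, HasSum (fun n => inner 𝕜 (b i) (ξ n) * inner 𝕜 (η n) (K (b i)))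
        (inner 𝕜 (b i) (T (K (b i)))) := by
      intro i _
      have := (h.2.mapL (ContinuousLinearMap.apply 𝕜 H (K (b i)))).mapL (innerSL 𝕜 (b i))
      simpa [inner_smul_right, mul_comm] using this
    refine ((hasSum_sum h1).tsum_eq.symm).trans (tsum_congr fun n => ?_)
    simp [map_sum, inner_sum, inner_smul_right]
  simp only [HasSum, SummationFilter.unconditional_filter, key]
  refine tendsto_tsum_of_dominated_convergence (h.1.mul_left ‖K‖) (fun n => ?_)
    (.of_forall fun F n => ?_)
  · have hb : HasSum (fun i => inner 𝕜 (b i) (ξ n) • b i) (ξ n) := by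
      simpa [b.repr_apply_apply] using b.hasSum_repr (ξ n)
    have := hb.map (innerSL 𝕜 (η n) ∘L K : H →L[𝕜] 𝕜) (ContinuousLinearMap.continuous _)
    simpa [HasSum, Function.comp_def, map_sum, inner_sum, inner_smul_right] using this
  · refine (norm_inner_apply_le _ _ _).trans ?_
    gcongr
    exact norm_sum_inner_smul_le b.orthonormal F (ξ n)

end Trace

/-- Used when the test element is built from the values being estimated, so that the quantity `s` to
be bounded reappears as `√s` on the right. -/
theorem le_sq_of_le_mul_sqrt {s a : ℝ} (hs : 0 ≤ s) (h : s ≤ a * √s) : s ≤ a ^ 2 := by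
  rcases hs.eq_or_lt with rfl | hs'
  · positivity
  · have h1 : √s * √s ≤ a * √s := by rwa [Real.mul_self_sqrt hs]
    have h2 : √s ≤ a := le_of_mul_le_mul_right h1 (Real.sqrt_pos.2 hs')
    exact (Real.sqrt_le_left ((Real.sqrt_nonneg s).trans h2)).1 h2

/-! ### Rank one expansions and eigenbases. -/

section Spectral

variable {𝕜 : Type v} {H : Type u} [RCLike 𝕜] [NormedAddCommGroup H] [InnerProductSpace 𝕜 H]

/-- The basis expansion gives pointwise convergence to `T`; only convergence in operator norm has to
be assumed. -/
theorem hasSum_rankOne_of_summable {ι : Type*} (b : HilbertBasis ι 𝕜 H) (T : H →L[𝕜] H)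
    (h : Summable fun i => rankOne 𝕜 (T (b i)) (b i)) :
    HasSum (fun i => rankOne 𝕜 (T (b i)) (b i)) T := by
  have hT : ∑' i, rankOne 𝕜 (T (b i)) (b i) = T := by
    ext x
    have h1 := h.hasSum.mapL (ContinuousLinearMap.apply 𝕜 H x)
    have h2 := (b.hasSum_repr x).mapL T
    simp only [ContinuousLinearMap.apply_apply, rankOne_apply] at h1
    simp only [b.repr_apply_apply, map_smul] at h2
    exact h1.unique h2
  have hs := h.hasSum
  rwa [hT] at hs

theorem norm_sum_rankOne_le {ι : Type*} {e : ι → H} (he : Orthonormal 𝕜 e) (f : ι → H)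
    (F : Finset ι) : ‖∑ i ∈ F, rankOne 𝕜 (f i) (e i)‖ ≤ √(∑ i ∈ F, ‖f i‖ ^ 2) := by
  refine ContinuousLinearMap.opNorm_le_bound _ (Real.sqrt_nonneg _) fun x => ?_
  calc ‖(∑ i ∈ F, rankOne 𝕜 (f i) (e i)) x‖ ≤ ∑ i ∈ F, ‖f i‖ * ‖inner 𝕜 (e i) x‖ := by
        rw [sum_apply]
        refine norm_sum_le_of_le _ fun i _ => ?_
        rw [rankOne_apply, norm_smul, mul_comm]
    _ ≤ √(∑ i ∈ F, ‖f i‖ ^ 2) * √(∑ i ∈ F, ‖inner 𝕜 (e i) x‖ ^ 2) :=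
        Real.sum_mul_le_sqrt_mul_sqrt _ _ _
    _ ≤ √(∑ i ∈ F, ‖f i‖ ^ 2) * ‖x‖ := by
        gcongr
        exact (Real.sqrt_le_left (norm_nonneg x)).2 (he.sum_inner_products_le x)

theorem norm_sum_rankOne_le' {ι : Type*} {e : ι → H} (he : Orthonormal 𝕜 e) (f : ι → H)
    (F : Finset ι) : ‖∑ i ∈ F, rankOne 𝕜 (e i) (f i)‖ ≤ √(∑ i ∈ F, ‖f i‖ ^ 2) := by
  refine ContinuousLinearMap.opNorm_le_bound _ (Real.sqrt_nonneg _) fun x => ?_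
  refine le_of_sq_le_sq ?_ (by positivity)
  rw [mul_pow, Real.sq_sqrt (by positivity), Finset.sum_mul, sum_apply]
  simp only [rankOne_apply]
  rw [norm_sum_smul_sq he]
  gcongr with i
  rw [← mul_pow]
  gcongr
  exact norm_inner_le_norm _ _

/-- The sum is a partial isometry: Pythagoras for `e`, then Bessel for `f`. -/
theorem norm_sum_rankOne_le_one {ι : Type*} {e f : ι → H} (he : Orthonormal 𝕜 e)
    (hf : Orthonormal 𝕜 f) (F : Finset ι) : ‖∑ i ∈ F, rankOne 𝕜 (e i) (f i)‖ ≤ 1 := by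
  refine ContinuousLinearMap.opNorm_le_bound _ zero_le_one fun x => ?_
  refine le_of_sq_le_sq ?_ (by positivity)
  rw [one_mul, sum_apply]
  simp only [rankOne_apply]
  rw [norm_sum_smul_sq he]
  exact hf.sum_inner_products_le x

/-- A compact self-adjoint operator has a Hilbert basis of eigenvectors. -/
theorem exists_eigenbasis [CompleteSpace H] {T : H →L[𝕜] H} (hT : IsCompactOperator T)
    (hT' : T.IsSymmetric) :
    ∃ (ι : Type (max u v)) (b : HilbertBasis ι 𝕜 H) (c : ι → 𝕜), ∀ i, T (b i) = c i • b i := by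
  let E : 𝕜 → Submodule 𝕜 H := fun μ => Module.End.eigenspace (T : Module.End 𝕜 H) μ
  have hmem : ∀ μ x, x ∈ E μ ↔ T x = μ • x := fun μ x => Module.End.mem_eigenspace_iff
  have hE : ∀ μ, CompleteSpace (E μ) := by
    intro μ
    have hcl : IsClosed (E μ : Set H) := by
      have : (E μ : Set H) = {x | T x = μ • x} := Set.ext fun x => hmem μ x
      rw [this]
      exact isClosed_eq T.continuous (continuous_const_smul μ)
    exact hcl.completeSpace_coe
  -- Bases of all eigenspaces, including the kernel at `μ = 0`, are glued together; the spectral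
  -- theorem makes their union total.
  choose w b hb using fun μ => exists_hilbertBasis 𝕜 (E μ)
  let g : (Σ μ, w μ) → H := fun a => b a.1 a.2
  have ho : Orthonormal 𝕜 g :=
    hT'.orthogonalFamily_eigenspaces.orthonormal_sigma_orthonormal fun μ => (b μ).orthonormal
  have hbot : (Submodule.span 𝕜 (Set.range g))ᗮ = ⊥ := by
    rw [eq_bot_iff, ← ContinuousLinearMap.orthogonalComplement_iSup_eigenspaces_eq_bot hT hT',
      ← Submodule.iInf_orthogonal, le_iInf_iff]
    intro μ x hx y hy
    have h1 := ((b μ).hasSum_repr ⟨y, hy⟩).mapL (innerSL 𝕜 x ∘L (E μ).subtypeL)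
    have h2 : ∀ i, inner 𝕜 x ((b μ i : E μ) : H) = 0 := fun i =>
      Submodule.inner_left_of_mem_orthogonal
        (Submodule.subset_span (Set.mem_range_self (f := g) ⟨μ, i⟩)) hx
    have h3 : HasSum (fun _ : w μ => (0 : 𝕜)) (inner 𝕜 x y) := by
      simpa [inner_smul_right, h2] using h1
    exact inner_eq_zero_symm.1 (h3.unique hasSum_zero)
  refine ⟨_, HilbertBasis.mkOfOrthogonalEqBot ho hbot, fun a => a.1, fun a => ?_⟩
  rw [HilbertBasis.coe_mkOfOrthogonalEqBot]
  exact (hmem _ _).1 (b a.1 a.2).2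

end Spectral

/-! ### From functionals on `K(H)` to trace class operators. -/

section Dual

variable {𝕜 : Type v} {H : Type u} [RCLike 𝕜] [NormedAddCommGroup H] [InnerProductSpace 𝕜 H]

/-- A bounded functional on `K(H)` is represented on rank one operators by a bounded operator. -/
theorem exists_inner_eq_apply_rankOne [CompleteSpace H] (φ : StrongDual 𝕜 (CompactOps 𝕜 H)) :
    ∃ T : H →L[𝕜] H, ∀ y z, inner 𝕜 z (T y) = φ (CompactOps.rankOne 𝕜 y z) := by
  -- `φ (y ⊗ z)` is linear in `y` and conjugate linear in `z`; conjugation gives the kind of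
  -- sesquilinear form that the Riesz representation requires.
  let B : H →L⋆[𝕜] H →L[𝕜] 𝕜 := LinearMap.mkContinuous₂
    (LinearMap.mk₂'ₛₗ (starRingEnd 𝕜) (RingHom.id 𝕜)
      (fun y z => starRingEnd 𝕜 (φ (CompactOps.rankOne 𝕜 y z)))
      (fun y y' z => by
        rw [← map_add, ← map_add]
        exact congrArg _ (congrArg φ (CompactOps.toOp_injective (by simp))))
      (fun c y z => by
        rw [smul_eq_mul, ← map_mul, ← smul_eq_mul, ← map_smul]
        exact congrArg _ (congrArg φ (CompactOps.toOp_injective (by simp))))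
      (fun y z z' => by
        rw [← map_add, ← map_add]
        exact congrArg _ (congrArg φ (CompactOps.toOp_injective (by simp))))
      (fun c y z => by
        rw [RingHom.id_apply, smul_eq_mul, ← RCLike.conj_conj c, ← map_mul, ← smul_eq_mul,
          ← map_smul]
        exact congrArg _ (congrArg φ (CompactOps.toOp_injective (by simp)))))
    ‖φ‖ fun y z => by
      simpa [mul_assoc, CompactOps.norm_rankOne] using φ.le_opNorm (CompactOps.rankOne 𝕜 y z)
  refine ⟨continuousLinearMapOfBilin B, fun y z => ?_⟩
  rw [← inner_conj_symm, continuousLinearMapOfBilin_apply]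
  exact RCLike.conj_conj _

/-- On `∑ eᵢ ⊗ T eᵢ` the functional takes the value `∑ ‖T eᵢ‖²`, while the operator norm of this sum
is at most the square root of that value. -/
theorem sum_norm_sq_le_of_inner_eq {φ : StrongDual 𝕜 (CompactOps 𝕜 H)} {T : H →L[𝕜] H}
    (hT : ∀ y z, inner 𝕜 z (T y) = φ (CompactOps.rankOne 𝕜 y z)) {ι : Type*} {e : ι → H}
    (he : Orthonormal 𝕜 e) (F : Finset ι) : ∑ i ∈ F, ‖T (e i)‖ ^ 2 ≤ ‖φ‖ ^ 2 := by
  have hs : 0 ≤ ∑ i ∈ F, ‖T (e i)‖ ^ 2 := by positivity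
  refine le_sq_of_le_mul_sqrt hs ?_
  have h1 := φ.le_opNorm (∑ i ∈ F, CompactOps.rankOne 𝕜 (e i) (T (e i)))
  have h2 : φ (∑ i ∈ F, CompactOps.rankOne 𝕜 (e i) (T (e i)))
      = ((∑ i ∈ F, ‖T (e i)‖ ^ 2 : ℝ) : 𝕜) := by
    simp [map_sum, ← hT, inner_self_eq_norm_sq_to_K]
  rw [h2, RCLike.norm_of_nonneg hs] at h1
  refine h1.trans ?_
  gcongr
  rw [← CompactOps.norm_toOp, map_sum]
  exact norm_sum_rankOne_le' he _ F

/-- An operator that represents a bounded functional on `K(H)` is Hilbert-Schmidt, hence compact. -/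
theorem isCompactOperator_of_inner_eq [CompleteSpace H] {φ : StrongDual 𝕜 (CompactOps 𝕜 H)}
    {T : H →L[𝕜] H} (hT : ∀ y z, inner 𝕜 z (T y) = φ (CompactOps.rankOne 𝕜 y z)) :
    IsCompactOperator T := by
  obtain ⟨w, b, -⟩ := exists_hilbertBasis 𝕜 H
  have hsq : Summable fun i => ‖T (b i)‖ ^ 2 :=
    summable_of_sum_le (fun i => by positivity) (sum_norm_sq_le_of_inner_eq hT b.orthonormal)
  -- The norms `‖T (b i)‖` are so far known only to be square summable, so the Cauchy criterion
  -- replaces absolute convergence.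
  have hsum : Summable fun i => rankOne 𝕜 (T (b i)) (b i) := by
    rw [summable_iff_vanishing_norm]
    intro ε hε
    obtain ⟨s, hs⟩ := summable_iff_vanishing_norm.1 hsq (ε ^ 2) (by positivity)
    refine ⟨s, fun t ht => (norm_sum_rankOne_le b.orthonormal _ t).trans_lt ?_⟩
    rw [Real.sqrt_lt' hε]
    exact (le_abs_self _).trans_lt (hs t ht)
  refine isCompactOperator_of_tendsto (hasSum_rankOne_of_summable b T hsum) (.of_forall fun F => ?_)
  exact (compactOperator (RingHom.id 𝕜) H H).sum_mem fun i _ =>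
    CompactOps.isCompactOperator_rankOne _ _

/-- An operator that represents a bounded functional on `K(H)` is trace class, and its projective
norm is at most the norm of the functional. -/
theorem exists_mem_nuclearValues_le [CompleteSpace H] {φ : StrongDual 𝕜 (CompactOps 𝕜 H)}
    {T : H →L[𝕜] H} (hT : ∀ y z, inner 𝕜 z (T y) = φ (CompactOps.rankOne 𝕜 y z)) :
    ∃ c ∈ nuclearValues T, c ≤ ‖φ‖ := by
  have hTc := isCompactOperator_of_inner_eq hT
  obtain ⟨ι, b, c, hb⟩ := exists_eigenbasis (T := ContinuousLinearMap.adjoint T ∘L T)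
    (hTc.clm_comp (ContinuousLinearMap.adjoint T))
    (fun x y => by
      simp [ContinuousLinearMap.adjoint_inner_left, ContinuousLinearMap.adjoint_inner_right])
  have horth : ∀ i j, i ≠ j → inner 𝕜 (T (b i)) (T (b j)) = 0 := by
    intro i j hij
    rw [← ContinuousLinearMap.adjoint_inner_right, ← ContinuousLinearMap.comp_apply, hb,
      inner_smul_right, b.orthonormal.2 hij, mul_zero]
  -- Only indices off the kernel allow normalising `T (b i)`; the others contribute nothing.
  let s : Set ι := {i | T (b i) ≠ 0}
  let f : s → H := fun i => ((‖T (b i)‖⁻¹ : ℝ) : 𝕜) • T (b i)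
  have hf : Orthonormal 𝕜 f := by
    refine ⟨fun i => ?_, fun i j hij => ?_⟩
    · have : ‖T (b i)‖ ≠ 0 := norm_ne_zero_iff.2 i.2
      rw [norm_smul, RCLike.norm_of_nonneg (by positivity), inv_mul_cancel₀ this]
    · simp only [f]
      rw [inner_smul_left, inner_smul_right, horth _ _ fun h => hij (Subtype.ext h)]
      simp
  have hinner : ∀ i : s, inner 𝕜 (f i) (T (b i)) = (‖T (b i)‖ : 𝕜) := by
    intro i
    have : (‖T (b i)‖ : 𝕜) ≠ 0 := by exact_mod_cast norm_ne_zero_iff.2 i.2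
    simp only [f]
    rw [inner_smul_left, inner_self_eq_norm_sq_to_K, RCLike.conj_ofReal, RCLike.ofReal_inv]
    field_simp
  have hle : ∀ F : Finset s, ∑ i ∈ F, ‖T (b i)‖ ≤ ‖φ‖ := by
    intro F
    have h1 := φ.le_opNorm (∑ i ∈ F, CompactOps.rankOne 𝕜 (b i) (f i))
    have h2 : φ (∑ i ∈ F, CompactOps.rankOne 𝕜 (b i) (f i)) = ((∑ i ∈ F, ‖T (b i)‖ : ℝ) : 𝕜) := by
      simp [map_sum, ← hT, hinner]
    rw [h2, RCLike.norm_of_nonneg (by positivity)] at h1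
    refine h1.trans (mul_le_of_le_one_right (norm_nonneg φ) ?_)
    rw [← CompactOps.norm_toOp, map_sum]
    exact norm_sum_rankOne_le_one (b.orthonormal.comp _ Subtype.val_injective) hf F
  have hs : Summable fun i : s => ‖T (b i)‖ := summable_of_sum_le (fun i => norm_nonneg _) hle
  have hsum : HasSum (fun i => ‖T (b i)‖) (∑' i : s, ‖T (b i)‖) :=
    (hasSum_subtype_iff_of_support_subset (f := fun i => ‖T (b i)‖)
      (fun i hi => by simpa [s] using hi)).1 hs.hasSum
  have hmul : (fun i => ‖T (b i)‖ * ‖b i‖) = fun i => ‖T (b i)‖ :=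
    funext fun i => by rw [b.orthonormal.1, mul_one]
  refine ⟨_, tsum_mem_nuclearValues (ξ := fun i => T (b i)) (η := b) (hmul ▸ hsum.summable)
    (hasSum_rankOne_of_summable b T ?_), ?_⟩
  · refine .of_norm_bounded hsum.summable fun i => ?_
    rw [norm_rankOne, b.orthonormal.1, mul_one]
  · rw [hmul, hsum.tsum_eq]
    exact hs.tsum_le_of_sum_le hle

end Dual

/-! ### Trace duality between `L¹(H)` and `K(H)`. -/

section Duality

variable {𝕜 : Type v} {H : Type u} [RCLike 𝕜] [NormedAddCommGroup H] [InnerProductSpace 𝕜 H]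

theorem IsNuclearRep.tsum_inner_rankOne {T : H →L[𝕜] H} {ξ η : ℕ → H} (h : IsNuclearRep T ξ η)
    (y z : H) : ∑' n, inner 𝕜 (η n) (rankOne 𝕜 y z (ξ n)) = inner 𝕜 z (T y) := by
  have h1 := (h.2.mapL (ContinuousLinearMap.apply 𝕜 H y)).mapL (innerSL 𝕜 z)
  refine Eq.trans (tsum_congr fun n => ?_) h1.tsum_eq
  simp [inner_smul_right, mul_comm]

/-- Compact operators are limits of operators of finite rank `P K`, with `P` the orthogonal
projection onto a finite dimensional subspace. -/
theorem exists_norm_sub_starProjection_comp_le {T : H →L[𝕜] H} (hT : IsCompactOperator T) {ε : ℝ}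
    (hε : 0 < ε) : ∃ (S : Submodule 𝕜 H) (_ : FiniteDimensional 𝕜 S),
      ‖T - S.starProjection ∘L T‖ ≤ ε := by
  -- The subspace is spanned by a finite `ε`-net of the image of the unit ball; projecting onto it
  -- is at least as good as moving to the nearest net point.
  have htb := (hT.isCompact_closure_image_closedBall (𝕜₁ := 𝕜)
    (f := (T : H →ₗ[𝕜] H)) 1).totallyBounded
  obtain ⟨t, ht, hcov⟩ := Metric.totallyBounded_iff.1 htb ε hε
  have := ht.to_subtype
  refine ⟨Submodule.span 𝕜 t, FiniteDimensional.span_of_finite 𝕜 ht, ?_⟩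
  have := FiniteDimensional.span_of_finite 𝕜 ht
  refine ContinuousLinearMap.opNorm_le_of_unit_norm hε.le fun x hx => ?_
  have hx' : T x ∈ closure ((T : H →ₗ[𝕜] H) '' Metric.closedBall 0 1) :=
    subset_closure ⟨x, by simp [hx], rfl⟩
  obtain ⟨y, hy, hxy⟩ := Set.mem_iUnion₂.1 (hcov hx')
  rw [sub_apply, ContinuousLinearMap.comp_apply,
    Submodule.starProjection_minimal]
  refine (ciInf_le ⟨0, ?_⟩ (⟨y, Submodule.subset_span hy⟩ : Submodule.span 𝕜 t)).trans ?_
  · rintro _ ⟨z, rfl⟩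
    exact norm_nonneg _
  · rw [← dist_eq_norm]
    exact (Metric.mem_ball.1 hxy).le

theorem TraceClass.exists_isNuclearRep (u : TraceClass 𝕜 H) :
    ∃ ξ η, IsNuclearRep (TraceClass.toOp 𝕜 H u) ξ η := by
  obtain ⟨_, ξ, η, h, -⟩ := u.nonempty_nuclearValues
  exact ⟨ξ, η, h⟩

variable [CompleteSpace H]

theorem starProjection_comp_eq_sum_rankOne (S : Submodule 𝕜 H) [FiniteDimensional 𝕜 S]
    (T : H →L[𝕜] H) : S.starProjection ∘L T = ∑ i, rankOne 𝕜 (stdOrthonormalBasis 𝕜 S i : H)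
      (ContinuousLinearMap.adjoint T (stdOrthonormalBasis 𝕜 S i : H)) := by
  ext x
  rw [ContinuousLinearMap.comp_apply, (stdOrthonormalBasis 𝕜 S).starProjection_eq_sum_rankOne]
  simp [sum_apply, ContinuousLinearMap.adjoint_inner_left]

/-- A bounded functional on `K(H)` that vanishes on the rank one operators is zero. -/
theorem eq_zero_of_apply_rankOne {φ : StrongDual 𝕜 (CompactOps 𝕜 H)}
    (hφ : ∀ y z, φ (CompactOps.rankOne 𝕜 y z) = 0) : φ = 0 := by
  ext K
  rw [zero_apply, ← norm_le_zero_iff]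
  refine le_of_forall_pos_le_add fun ε hε => ?_
  have hpos : 0 < ‖φ‖ + 1 := by positivity
  obtain ⟨S, hS, hK⟩ := exists_norm_sub_starProjection_comp_le K.isCompactOperator_toOp
    (div_pos hε hpos)
  set L := CompactOps.sandwich S.starProjection (.id 𝕜 H) K with hL
  have hφL : φ L = 0 := by
    have : L = ∑ i, CompactOps.rankOne 𝕜 (stdOrthonormalBasis 𝕜 S i : H)
        (ContinuousLinearMap.adjoint (CompactOps.toOp 𝕜 H K) (stdOrthonormalBasis 𝕜 S i : H)) := by
      refine CompactOps.toOp_injective ?_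
      rw [map_sum, hL, CompactOps.toOp_sandwich]
      exact starProjection_comp_eq_sum_rankOne S _
    rw [this, map_sum]
    exact Finset.sum_eq_zero fun i _ => hφ _ _
  have hKL : ‖K - L‖ ≤ ε / (‖φ‖ + 1) := by
    rw [← CompactOps.norm_toOp, map_sub]
    exact hK
  calc ‖φ K‖ = ‖φ (K - L)‖ := by rw [map_sub, hφL, sub_zero]
    _ ≤ ‖φ‖ * ‖K - L‖ := φ.le_opNorm _
    _ ≤ (‖φ‖ + 1) * (ε / (‖φ‖ + 1)) := by gcongr; linarith
    _ = 0 + ε := by field_simp; ring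

namespace TraceClass

/-- The trace `tr (u K) = ∑ᵢ ⟨bᵢ, u K bᵢ⟩`, computed in some Hilbert basis `b`. -/
noncomputable def trace (u : TraceClass 𝕜 H) (K : H →L[𝕜] H) : 𝕜 :=
  ∑' i, inner 𝕜 ((exists_hilbertBasis 𝕜 H).choose_spec.choose i)
    (toOp 𝕜 H u (K ((exists_hilbertBasis 𝕜 H).choose_spec.choose i)))

theorem trace_eq_tsum {u : TraceClass 𝕜 H} {ξ η : ℕ → H} (h : IsNuclearRep (toOp 𝕜 H u) ξ η)
    (K : H →L[𝕜] H) : u.trace K = ∑' n, inner 𝕜 (η n) (K (ξ n)) :=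
  (h.hasSum_trace K _).tsum_eq

theorem hasSum_trace (u : TraceClass 𝕜 H) (K : H →L[𝕜] H) {ι : Type*} (b : HilbertBasis ι 𝕜 H) :
    HasSum (fun i => inner 𝕜 (b i) (toOp 𝕜 H u (K (b i)))) (u.trace K) := by
  obtain ⟨ξ, η, h⟩ := u.exists_isNuclearRep
  exact trace_eq_tsum h K ▸ h.hasSum_trace K b

theorem norm_trace_le (u : TraceClass 𝕜 H) (K : H →L[𝕜] H) : ‖u.trace K‖ ≤ ‖u‖ * ‖K‖ := by
  have h : ∀ c ∈ nuclearValues (toOp 𝕜 H u), ‖u.trace K‖ ≤ c * ‖K‖ := by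
    rintro _ ⟨ξ, η, h, rfl⟩
    rw [trace_eq_tsum h, mul_comm, ← tsum_mul_left]
    exact tsum_of_norm_bounded (h.1.mul_left ‖K‖).hasSum fun n => norm_inner_apply_le K (ξ n) (η n)
  rcases (norm_nonneg K).eq_or_lt with hK | hK
  · obtain ⟨c, hc⟩ := u.nonempty_nuclearValues
    simpa [← hK] using h c hc
  · rw [← div_le_iff₀ hK]
    exact le_csInf u.nonempty_nuclearValues fun c hc => (div_le_iff₀ hK).2 (h c hc)

theorem trace_rankOne (u : TraceClass 𝕜 H) (y z : H) :
    u.trace (rankOne 𝕜 y z) = inner 𝕜 z (toOp 𝕜 H u y) := by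
  obtain ⟨ξ, η, h⟩ := u.exists_isNuclearRep
  rw [trace_eq_tsum h, h.tsum_inner_rankOne]

variable (𝕜 H) in
/-- The trace pairing `u ↦ (K ↦ tr (u K))`. -/
noncomputable def tracePairing : TraceClass 𝕜 H →ₗ[𝕜] StrongDual 𝕜 (CompactOps 𝕜 H) :=
  let hb := (exists_hilbertBasis 𝕜 H).choose_spec.choose
  { toFun := fun u => LinearMap.mkContinuous
      { toFun := fun K => u.trace (CompactOps.toOp 𝕜 H K)
        map_add' := fun K L => by
          have h := (u.hasSum_trace (CompactOps.toOp 𝕜 H K) hb).add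
            (u.hasSum_trace (CompactOps.toOp 𝕜 H L) hb)
          refine (u.hasSum_trace _ hb).unique ?_
          simpa [inner_add_right] using h
        map_smul' := fun c K => by
          have h := (u.hasSum_trace (CompactOps.toOp 𝕜 H K) hb).mul_left c
          refine (u.hasSum_trace _ hb).unique ?_
          simpa [inner_smul_right] using h }
      ‖u‖ fun K => u.norm_trace_le _
    map_add' := fun u v => by
      ext K
      have h := (u.hasSum_trace (CompactOps.toOp 𝕜 H K) hb).add
        (v.hasSum_trace (CompactOps.toOp 𝕜 H K) hb)
      refine ((u + v).hasSum_trace _ hb).unique ?_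
      change HasSum _ (u.trace _ + v.trace _)
      simpa [inner_add_right] using h
    map_smul' := fun c u => by
      ext K
      have h := (u.hasSum_trace (CompactOps.toOp 𝕜 H K) hb).mul_left c
      refine ((c • u).hasSum_trace _ hb).unique ?_
      change HasSum _ (c * u.trace _)
      simpa [inner_smul_right] using h }

/-- The trace estimate gives one inequality; the other holds because the functional yields a nuclear
representation of `u` itself of cost at most its norm. -/
theorem norm_tracePairing (u : TraceClass 𝕜 H) : ‖tracePairing 𝕜 H u‖ = ‖u‖ := by
  refine le_antisymm ?_ ?_
  · exact ContinuousLinearMap.opNorm_le_bound _ (norm_nonneg u) fun K => u.norm_trace_le _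
  · obtain ⟨c, hc, hle⟩ := exists_mem_nuclearValues_le (φ := tracePairing 𝕜 H u)
      (T := toOp 𝕜 H u) fun y z => (u.trace_rankOne y z).symm
    exact (projNorm_le hc).trans hle

theorem tracePairing_surjective : Function.Surjective (tracePairing 𝕜 H) := by
  intro φ
  obtain ⟨T, hT⟩ := exists_inner_eq_apply_rankOne φ
  obtain ⟨c, hc, -⟩ := exists_mem_nuclearValues_le hT
  let u : TraceClass 𝕜 H := ⟨T, c, hc⟩
  refine ⟨u, sub_eq_zero.1 (eq_zero_of_apply_rankOne fun y z => ?_)⟩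
  rw [sub_apply, ← hT, sub_eq_zero]
  exact u.trace_rankOne y z

variable (𝕜 H) in
/-- `L¹(H)` is the dual of `K(H)` through the trace pairing. -/
noncomputable def traceDuality : TraceClass 𝕜 H ≃ₗᵢ[𝕜] StrongDual 𝕜 (CompactOps 𝕜 H) :=
  LinearIsometryEquiv.ofSurjective ⟨tracePairing 𝕜 H, norm_tracePairing⟩ tracePairing_surjective

theorem isTraceDuality_traceDuality : IsTraceDuality (traceDuality 𝕜 H) :=
  fun u K _ b => u.hasSum_trace (CompactOps.toOp 𝕜 H K) b

end TraceClass

end Duality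

/-! ### Compressions and the lower 2-estimate. -/

section BlockDecomposition

variable {𝕜 : Type v} {H : Type u} [RCLike 𝕜] [NormedAddCommGroup H] [InnerProductSpace 𝕜 H]

/-- If `(K, L) ↦ A K + B L` is contractive for the Euclidean norm on the pairs, then its transpose
is contractive, too. -/
theorem norm_comp_sq_add_norm_comp_sq_le {E : Type*} [NormedAddCommGroup E] [NormedSpace 𝕜 E]
    {A B : E →L[𝕜] E} (hAB : ∀ K L, ‖A K + B L‖ ^ 2 ≤ ‖K‖ ^ 2 + ‖L‖ ^ 2) (φ : StrongDual 𝕜 E) :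
    ‖φ ∘L A‖ ^ 2 + ‖φ ∘L B‖ ^ 2 ≤ ‖φ‖ ^ 2 := by
  let : NormedSpace ℝ E := NormedSpace.restrictScalars ℝ 𝕜 E
  have key : ∀ K L, ‖K‖ = 1 → ‖L‖ = 1 → ‖φ (A K)‖ ^ 2 + ‖φ (B L)‖ ^ 2 ≤ ‖φ‖ ^ 2 := by
    intro K L hK hL
    set a := φ (A K)
    set b := φ (B L)
    have hs : 0 ≤ ‖a‖ ^ 2 + ‖b‖ ^ 2 := by positivity
    refine le_sq_of_le_mul_sqrt hs ?_
    -- The conjugate weights align the phases, so that `φ` takes the value `‖a‖² + ‖b‖²`.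
    have h1 := φ.le_opNorm (A (starRingEnd 𝕜 a • K) + B (starRingEnd 𝕜 b • L))
    have h2 : φ (A (starRingEnd 𝕜 a • K) + B (starRingEnd 𝕜 b • L))
        = ((‖a‖ ^ 2 + ‖b‖ ^ 2 : ℝ) : 𝕜) := by
      simp only [map_add, map_smul, smul_eq_mul]
      rw [RCLike.conj_mul, RCLike.conj_mul]
      push_cast
      rfl
    rw [h2, RCLike.norm_of_nonneg hs] at h1
    refine h1.trans ?_
    gcongr
    refine Real.le_sqrt_of_sq_le ((hAB _ _).trans_eq ?_)
    simp [norm_smul, hK, hL]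
  have key' : ∀ L, ‖L‖ = 1 → ‖φ ∘L A‖ ^ 2 + ‖φ (B L)‖ ^ 2 ≤ ‖φ‖ ^ 2 := by
    intro L hL
    have hb : ‖φ (B L)‖ ^ 2 ≤ ‖φ‖ ^ 2 := by
      have := key L L hL hL
      nlinarith [sq_nonneg ‖φ (A L)‖]
    have h : ‖φ ∘L A‖ ≤ √(‖φ‖ ^ 2 - ‖φ (B L)‖ ^ 2) := by
      refine ContinuousLinearMap.opNorm_le_of_unit_norm (Real.sqrt_nonneg _) fun K hK => ?_
      refine Real.le_sqrt_of_sq_le ?_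
      have := key K L hK hL
      simp only [ContinuousLinearMap.comp_apply]
      linarith
    have := (Real.le_sqrt (norm_nonneg _) (by linarith)).1 h
    linarith
  rcases subsingleton_or_nontrivial E with hE | hE
  · have hz : ∀ ψ : StrongDual 𝕜 E, ψ = 0 := fun ψ => by
      ext K
      rw [Subsingleton.elim K 0, map_zero, map_zero]
    simp [hz (φ ∘L A), hz (φ ∘L B)]
  obtain ⟨L, hL⟩ := exists_norm_eq E zero_le_one
  have hA : ‖φ ∘L A‖ ^ 2 ≤ ‖φ‖ ^ 2 := by
    have := key' L hL
    nlinarith [sq_nonneg ‖φ (B L)‖]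
  have h : ‖φ ∘L B‖ ≤ √(‖φ‖ ^ 2 - ‖φ ∘L A‖ ^ 2) := by
    refine ContinuousLinearMap.opNorm_le_of_unit_norm (Real.sqrt_nonneg _) fun L hL => ?_
    refine Real.le_sqrt_of_sq_le ?_
    have := key' L hL
    simp only [ContinuousLinearMap.comp_apply]
    linarith
  have := (Real.le_sqrt (norm_nonneg _) (by linarith)).1 h
  linarith

variable (S : Submodule 𝕜 H) [S.HasOrthogonalProjection]

/-- Cauchy-Schwarz, as the squared norms of the two components of `x` add up to `‖x‖²`. -/
theorem norm_comp_starProjection_add_sq_le (K L : CompactOps 𝕜 H) :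
    ‖CompactOps.sandwich (.id 𝕜 H) S.starProjection K
      + CompactOps.sandwich (.id 𝕜 H) Sᗮ.starProjection L‖ ^ 2 ≤ ‖K‖ ^ 2 + ‖L‖ ^ 2 := by
  rw [← Real.le_sqrt (norm_nonneg _) (by positivity), ← CompactOps.norm_toOp]
  refine ContinuousLinearMap.opNorm_le_bound _ (Real.sqrt_nonneg _) fun x => ?_
  have hx := S.norm_sq_eq_add_norm_sq_starProjection x
  have h1 := (CompactOps.toOp 𝕜 H K).le_opNorm (S.starProjection x)
  have h2 := (CompactOps.toOp 𝕜 H L).le_opNorm (Sᗮ.starProjection x)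
  rw [CompactOps.norm_toOp] at h1 h2
  refine (norm_add_le _ _).trans ((add_le_add h1 h2).trans ?_)
  refine le_of_sq_le_sq ?_ (by positivity)
  rw [mul_pow, Real.sq_sqrt (by positivity), hx]
  nlinarith [sq_nonneg (‖K‖ * ‖Sᗮ.starProjection x‖ - ‖L‖ * ‖S.starProjection x‖)]

/-- The two terms have orthogonal ranges, so Pythagoras applies. -/
theorem norm_starProjection_comp_add_sq_le (K L : CompactOps 𝕜 H) :
    ‖CompactOps.sandwich S.starProjection (.id 𝕜 H) K
      + CompactOps.sandwich Sᗮ.starProjection (.id 𝕜 H) L‖ ^ 2 ≤ ‖K‖ ^ 2 + ‖L‖ ^ 2 := by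
  rw [← Real.le_sqrt (norm_nonneg _) (by positivity), ← CompactOps.norm_toOp]
  refine ContinuousLinearMap.opNorm_le_bound _ (Real.sqrt_nonneg _) fun x => ?_
  have h1 := (CompactOps.toOp 𝕜 H K).le_opNorm x
  have h2 := (CompactOps.toOp 𝕜 H L).le_opNorm x
  have h3 := S.norm_starProjection_apply_le (CompactOps.toOp 𝕜 H K x)
  have h4 := Sᗮ.norm_starProjection_apply_le (CompactOps.toOp 𝕜 H L x)
  rw [CompactOps.norm_toOp] at h1 h2
  have horth : inner 𝕜 (S.starProjection (CompactOps.toOp 𝕜 H K x))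
      (Sᗮ.starProjection (CompactOps.toOp 𝕜 H L x)) = 0 :=
    Submodule.inner_right_of_mem_orthogonal (S.starProjection_apply_mem _)
      (Sᗮ.starProjection_apply_mem _)
  refine le_of_sq_le_sq ?_ (by positivity)
  rw [mul_pow, Real.sq_sqrt (by positivity)]
  have h5 := norm_add_sq_eq_norm_sq_add_norm_sq_of_inner_eq_zero _ _ horth
  calc ‖S.starProjection (CompactOps.toOp 𝕜 H K x)
        + Sᗮ.starProjection (CompactOps.toOp 𝕜 H L x)‖ ^ 2
      = ‖S.starProjection (CompactOps.toOp 𝕜 H K x)‖ ^ 2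
        + ‖Sᗮ.starProjection (CompactOps.toOp 𝕜 H L x)‖ ^ 2 := by linarith
    _ ≤ (‖K‖ * ‖x‖) ^ 2 + (‖L‖ * ‖x‖) ^ 2 := by
        gcongr
        · exact h3.trans h1
        · exact h4.trans h2
    _ = (‖K‖ ^ 2 + ‖L‖ ^ 2) * ‖x‖ ^ 2 := by ring

/-- The functional `K ↦ φ (P K P)`, where `P` is the orthogonal projection onto `S`. -/
noncomputable def compression (φ : StrongDual 𝕜 (CompactOps 𝕜 H)) : StrongDual 𝕜 (CompactOps 𝕜 H) :=
  φ ∘L CompactOps.sandwich S.starProjection S.starProjection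

theorem compression_sub (φ ψ : StrongDual 𝕜 (CompactOps 𝕜 H)) :
    compression S (φ - ψ) = compression S φ - compression S ψ := rfl

/-- The compression of a functional and the remainder satisfy a lower `2`-estimate. -/
theorem norm_compression_sq_add_le (φ : StrongDual 𝕜 (CompactOps 𝕜 H)) :
    ‖compression S φ‖ ^ 2 + ‖φ - compression S φ‖ ^ 2 / 2 ≤ ‖φ‖ ^ 2 := by
  set φP := φ ∘L CompactOps.sandwich S.starProjection (.id 𝕜 H)
  set φQ := φ ∘L CompactOps.sandwich Sᗮ.starProjection (.id 𝕜 H)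
  have h1 : ‖φP‖ ^ 2 + ‖φQ‖ ^ 2 ≤ ‖φ‖ ^ 2 :=
    norm_comp_sq_add_norm_comp_sq_le (norm_starProjection_comp_add_sq_le S) φ
  have h2 := norm_comp_sq_add_norm_comp_sq_le (norm_comp_starProjection_add_sq_le S) φP
  have h3 : φP ∘L CompactOps.sandwich (.id 𝕜 H) S.starProjection = compression S φ := rfl
  set φPQ := φP ∘L CompactOps.sandwich (.id 𝕜 H) Sᗮ.starProjection
  rw [h3] at h2
  -- With `Q = 1 - P`, split `K = PKP + PKQ + QK`. Two pieces remain outside the compression, and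
  -- `(a + b)² ≤ 2 (a² + b²)` costs the factor `1/2`.
  have h4 : φ - compression S φ = φPQ + φQ := by
    ext K
    have hK : K = CompactOps.sandwich S.starProjection S.starProjection K
        + (CompactOps.sandwich S.starProjection Sᗮ.starProjection K
          + CompactOps.sandwich Sᗮ.starProjection (.id 𝕜 H) K) := by
      refine CompactOps.toOp_injective ?_
      ext x
      have hx := congrArg S.starProjection (congrArg (CompactOps.toOp 𝕜 H K)
        (S.starProjection_add_starProjection_orthogonal x))
      rw [map_add, map_add] at hx
      have hx' := S.starProjection_add_starProjection_orthogonal (CompactOps.toOp 𝕜 H K x)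
      rw [← hx, add_assoc] at hx'
      exact hx'.symm
    have := congrArg φ hK
    rw [map_add, map_add] at this
    exact sub_eq_iff_eq_add'.2 this
  have h5 : ‖φ - compression S φ‖ ≤ ‖φPQ‖ + ‖φQ‖ := h4 ▸ norm_add_le _ _
  have h6 : ‖φ - compression S φ‖ ^ 2 ≤ (‖φPQ‖ + ‖φQ‖) ^ 2 := by gcongr
  nlinarith [sq_nonneg (‖φPQ‖ - ‖φQ‖)]

/-- `P K P` is a combination of finitely many `eᵢ ⊗ eⱼ` with coefficients at most `‖K‖`. Hence weak*
closeness controls compressions in norm. -/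
theorem norm_compression_le_sum [FiniteDimensional 𝕜 S] (φ : StrongDual 𝕜 (CompactOps 𝕜 H)) :
    ‖compression S φ‖ ≤ ∑ i, ∑ j, ‖φ (CompactOps.rankOne 𝕜 (stdOrthonormalBasis 𝕜 S i : H)
      (stdOrthonormalBasis 𝕜 S j : H))‖ := by
  set e := stdOrthonormalBasis 𝕜 S
  refine ContinuousLinearMap.opNorm_le_bound _ (by positivity) fun K => ?_
  have hK : CompactOps.sandwich S.starProjection S.starProjection K
      = ∑ i, ∑ j, inner 𝕜 (e i : H) (CompactOps.toOp 𝕜 H K (e j : H)) •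
        CompactOps.rankOne 𝕜 (e i : H) (e j : H) := by
    refine CompactOps.toOp_injective ?_
    ext x
    rw [CompactOps.toOp_sandwich, e.starProjection_eq_sum_rankOne]
    simp only [map_sum, sum_apply, map_smul, ContinuousLinearMap.comp_apply, rankOne_apply,
      smul_apply, CompactOps.toOp_rankOne, Finset.smul_sum, smul_smul]
    rw [Finset.sum_comm]
    simp only [mul_comm]
  have he : ∀ i, ‖(e i : H)‖ = 1 := fun i => e.norm_eq_one i
  simp only [compression, ContinuousLinearMap.comp_apply, hK, map_sum, map_smul]
  rw [Finset.sum_mul]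
  refine norm_sum_le_of_le _ fun i _ => ?_
  rw [Finset.sum_mul]
  refine norm_sum_le_of_le _ fun j _ => ?_
  rw [norm_smul, mul_comm]
  gcongr
  have := norm_inner_apply_le (CompactOps.toOp 𝕜 H K) (e j : H) (e i : H)
  rwa [he, he, mul_one, mul_one, CompactOps.norm_toOp] at this

end BlockDecomposition

/-! ### Weak* cluster points and the UKK* property. -/

section UKK

variable {𝕜 : Type v} {H : Type u} [RCLike 𝕜] [NormedAddCommGroup H] [InnerProductSpace 𝕜 H]
  [CompleteSpace H]

/-- Trace class functionals are approximated in norm by their compressions to finite dimensional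
subspaces. -/
theorem exists_norm_sub_compression_le (φ : StrongDual 𝕜 (CompactOps 𝕜 H)) {ε : ℝ} (hε : 0 < ε) :
    ∃ (S : Submodule 𝕜 H) (_ : FiniteDimensional 𝕜 S), ‖φ - compression S φ‖ ≤ ε := by
  classical
  obtain ⟨u, rfl⟩ := (TraceClass.traceDuality 𝕜 H).surjective φ
  obtain ⟨ξ, η, h⟩ := u.exists_isNuclearRep
  -- Terms in `F` vanish since `S` contains their vectors. Outside `F` the original and the
  -- compressed term each cost `‖K‖ ‖ξ n‖ ‖η n‖`, hence the factor 2.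
  have h2 := h.1.mul_left 2
  obtain ⟨F, hF⟩ := ((tendsto_tsum_compl_atTop_zero fun n => 2 * (‖ξ n‖ * ‖η n‖)).eventually
    (gt_mem_nhds hε)).exists
  have hc0 : 0 ≤ ∑' n : {n // n ∉ F}, 2 * (‖ξ n‖ * ‖η n‖) := tsum_nonneg fun n => by positivity
  generalize hcF : ∑' n : {n // n ∉ F}, 2 * (‖ξ n‖ * ‖η n‖) = c at hF hc0
  have hc : HasSum (Set.indicator {n | n ∉ F} fun n => 2 * (‖ξ n‖ * ‖η n‖)) c :=
    hasSum_subtype_iff_indicator.1 (hcF ▸ (h2.subtype {n | n ∉ F}).hasSum)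
  obtain ⟨S, hS, hξ, hη⟩ : ∃ (S : Submodule 𝕜 H) (_ : FiniteDimensional 𝕜 S),
      (∀ n ∈ F, ξ n ∈ S) ∧ ∀ n ∈ F, η n ∈ S :=
    ⟨Submodule.span 𝕜 (ξ '' F ∪ η '' F),
      FiniteDimensional.span_of_finite 𝕜 ((F.finite_toSet.image ξ).union (F.finite_toSet.image η)),
      fun n hn => Submodule.subset_span (.inl ⟨n, hn, rfl⟩),
      fun n hn => Submodule.subset_span (.inr ⟨n, hn, rfl⟩)⟩
  refine ⟨S, hS, ?_⟩
  set P := S.starProjection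
  refine (ContinuousLinearMap.opNorm_le_bound _ hc0 fun K => ?_).trans hF.le
  have hK : (TraceClass.traceDuality 𝕜 H u - compression S (TraceClass.traceDuality 𝕜 H u)) K
      = ∑' n, (inner 𝕜 (η n) (CompactOps.toOp 𝕜 H K (ξ n))
        - inner 𝕜 (η n) ((P ∘L CompactOps.toOp 𝕜 H K ∘L P) (ξ n))) := by
    have h3 := (summable_inner_apply h.1 (CompactOps.toOp 𝕜 H K)).tsum_sub
      (summable_inner_apply h.1 (P ∘L CompactOps.toOp 𝕜 H K ∘L P))
    rw [← TraceClass.trace_eq_tsum h, ← TraceClass.trace_eq_tsum h] at h3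
    exact h3.symm
  rw [hK, mul_comm]
  refine tsum_of_norm_bounded (hc.mul_left ‖K‖) fun n => ?_
  have hsymm : inner 𝕜 (η n) ((P ∘L CompactOps.toOp 𝕜 H K ∘L P) (ξ n))
      = inner 𝕜 (P (η n)) (CompactOps.toOp 𝕜 H K (P (ξ n))) :=
    (S.inner_starProjection_left_eq_right _ _).symm
  rw [hsymm]
  by_cases hn : n ∈ F
  · rw [Submodule.starProjection_eq_self_iff.2 (hξ n hn),
      Submodule.starProjection_eq_self_iff.2 (hη n hn)]
    simp [hn]
  · rw [Set.indicator_of_mem (show n ∈ {n | n ∉ F} from hn)]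
    have h3 := norm_inner_apply_le (CompactOps.toOp 𝕜 H K) (ξ n) (η n)
    have h4 : ‖inner 𝕜 (P (η n)) (CompactOps.toOp 𝕜 H K (P (ξ n)))‖ ≤ ‖K‖ * (‖ξ n‖ * ‖η n‖) := by
      refine (norm_inner_apply_le _ _ _).trans ?_
      rw [CompactOps.norm_toOp]
      gcongr <;> exact Submodule.norm_starProjection_apply_le _ _
    rw [CompactOps.norm_toOp] at h3
    refine (norm_sub_le _ _).trans ?_
    linarith

/-- A weak* cluster point of a `ρ`-separated sequence in the unit ball of `K(H)*` has norm at most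
`1 - ρ² / 128`. -/
theorem norm_le_of_mapClusterPt {φ : ℕ → StrongDual 𝕜 (CompactOps 𝕜 H)}
    {ψ : StrongDual 𝕜 (CompactOps 𝕜 H)} {ρ : ℝ} (hρ : 0 < ρ) (hφ : ∀ n, ‖φ n‖ ≤ 1)
    (hsep : ∀ n m, n ≠ m → ρ ≤ ‖φ n - φ m‖)
    (hcl : MapClusterPt (StrongDual.toWeakDual ψ) Filter.atTop
      fun n => StrongDual.toWeakDual (φ n)) : ‖ψ‖ ≤ 1 - ρ ^ 2 / 128 := by
  have hρ2 : ρ ≤ 2 := by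
    have := (hsep 0 1 zero_ne_one).trans (norm_sub_le _ _)
    linarith [hφ 0, hφ 1]
  have hη : 0 < ρ ^ 2 / 256 := by positivity
  obtain ⟨S, hS, hψ⟩ := exists_norm_sub_compression_le ψ hη
  set e := stdOrthonormalBasis 𝕜 S
  let U : Set (WeakDual 𝕜 (CompactOps 𝕜 H)) := {w | ∑ i, ∑ j,
    ‖w (CompactOps.rankOne 𝕜 (e i : H) (e j : H)) - ψ (CompactOps.rankOne 𝕜 (e i : H) (e j : H))‖
      < ρ ^ 2 / 256}
  have hU : IsOpen U := by
    refine isOpen_lt (continuous_finsetSum _ fun i _ => continuous_finsetSum _ fun j _ => ?_)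
      continuous_const
    exact ((WeakDual.eval_continuous _).sub continuous_const).norm
  have hψU : StrongDual.toWeakDual ψ ∈ U := by
    change ∑ i, ∑ j, ‖ψ (CompactOps.rankOne 𝕜 (e i : H) (e j : H))
      - ψ (CompactOps.rankOne 𝕜 (e i : H) (e j : H))‖ < ρ ^ 2 / 256
    simpa using hη
  have hfreq := hcl.frequently (hU.mem_nhds hψU)
  have hclose : ∀ n, StrongDual.toWeakDual (φ n) ∈ U →
      ‖compression S (φ n) - compression S ψ‖ ≤ ρ ^ 2 / 256 := by
    intro n hn
    rw [← compression_sub]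
    exact (norm_compression_le_sum S _).trans (le_of_lt hn)
  -- A remainder of at least `ρ / 4` gives `‖compression S (φ n)‖² ≤ 1 - ρ² / 32`, so its norm is at
  -- most `1 - ρ² / 64`; the two approximations return `2 · ρ² / 256`.
  have hfar : ∀ n, StrongDual.toWeakDual (φ n) ∈ U → ρ / 4 ≤ ‖φ n - compression S (φ n)‖ →
      ‖ψ‖ ≤ 1 - ρ ^ 2 / 128 := by
    intro n hn hr
    have h1 := norm_compression_sq_add_le S (φ n)
    have h2 : (ρ / 4) ^ 2 ≤ ‖φ n - compression S (φ n)‖ ^ 2 := by gcongr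
    have h3 : ‖φ n‖ ^ 2 ≤ 1 := pow_le_one₀ (norm_nonneg _) (hφ n)
    have h4 : ‖compression S (φ n)‖ ≤ 1 - ρ ^ 2 / 64 := by
      refine le_of_sq_le_sq ?_ (by nlinarith)
      nlinarith [sq_nonneg (ρ ^ 2 / 64)]
    have h5 : ‖ψ‖ ≤ ‖ψ - compression S ψ‖ + ‖compression S (φ n) - compression S ψ‖
        + ‖compression S (φ n)‖ := by
      calc ‖ψ‖ = ‖(ψ - compression S ψ) - (compression S (φ n) - compression S ψ)
            + compression S (φ n)‖ := by congr 1; abel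
        _ ≤ _ := (norm_add_le _ _).trans (by gcongr; exact norm_sub_le _ _)
    linarith [hclose n hn]
  obtain ⟨n, -, hn⟩ := Filter.frequently_atTop.1 hfreq 0
  obtain ⟨m, hnm, hm⟩ := Filter.frequently_atTop.1 hfreq (n + 1)
  by_cases h1 : ρ / 4 ≤ ‖φ n - compression S (φ n)‖
  · exact hfar n hn h1
  by_cases h2 : ρ / 4 ≤ ‖φ m - compression S (φ m)‖
  · exact hfar m hm h2
  -- Otherwise `‖φ n - φ m‖ < ρ / 2 + ρ² / 128`, which is less than `ρ` because `ρ ≤ 2`.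
  exfalso
  have h3 : ‖φ n - φ m‖ ≤ ‖φ n - compression S (φ n)‖ + ‖φ m - compression S (φ m)‖
      + (‖compression S (φ n) - compression S ψ‖ + ‖compression S (φ m) - compression S ψ‖) := by
    calc ‖φ n - φ m‖ = ‖((φ n - compression S (φ n)) - (φ m - compression S (φ m)))
          + ((compression S (φ n) - compression S ψ) - (compression S (φ m) - compression S ψ))‖ := by
          congr 1; abel
      _ ≤ _ := (norm_add_le _ _).trans (by gcongr <;> exact norm_sub_le _ _)
  have h4 := hsep n m (by omega)
  nlinarith [hclose n hn, hclose m hm]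

theorem TraceClass.uKKStar_traceDuality : UKKStar (TraceClass.traceDuality 𝕜 H) := by
  intro ε hε
  -- This is `ρ² / 128` at `ρ = ε / 2`, as the supremum need not be attained; the minimum with `1/2`
  -- keeps `δ < 1`.
  refine ⟨min (ε ^ 2 / 512) (1 / 2), ⟨by positivity, (min_le_right _ _).trans_lt (by norm_num)⟩, ?_⟩
  intro C hC _ hball hsup
  -- The real supremum of the empty set is 0, which `ε > 0` excludes.
  have hne : {s | ∃ x : ℕ → TraceClass 𝕜 H, (∀ n, x n ∈ C) ∧ s = sep x}.Nonempty := by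
    by_contra h
    rw [Set.not_nonempty_iff_eq_empty] at h
    rw [h, Real.sSup_empty] at hsup
    linarith
  obtain ⟨_, ⟨x, hxC, rfl⟩, hx⟩ := exists_lt_of_lt_csSup hne ((half_lt_self hε).trans_le hsup)
  have hsep : ∀ n m, n ≠ m → ε / 2 ≤ ‖x n - x m‖ := by
    intro n m hnm
    refine hx.le.trans (csInf_le ⟨0, ?_⟩ ⟨n, m, hnm, rfl⟩)
    rintro _ ⟨_, _, _, rfl⟩
    exact norm_nonneg _
  obtain ⟨_, ⟨y, hyC, rfl⟩, hy⟩ := IsCompact.exists_mapClusterPt hC (f := Filter.atTop)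
    (u := fun n => StrongDual.toWeakDual (TraceClass.traceDuality 𝕜 H (x n)))
    (Filter.le_principal_iff.2 (Filter.mem_map.2 (Filter.univ_mem' fun n => ⟨x n, hxC n, rfl⟩)))
  have hle := norm_le_of_mapClusterPt (half_pos hε)
    (fun n => by simpa using hball (hxC n))
    (fun n m hnm => by simpa only [← map_sub, LinearIsometryEquiv.norm_map] using hsep n m hnm) hy
  rw [LinearIsometryEquiv.norm_map] at hle
  refine ⟨y, hyC, ?_⟩
  rw [mem_closedBall_zero_iff]
  have := min_le_left (ε ^ 2 / 512) (1 / 2)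
  linarith

end UKK

theorem theorem4p3 {𝕜 : Type v} [RCLike 𝕜] (H : Type u) [NormedAddCommGroup H]
    [InnerProductSpace 𝕜 H] [CompleteSpace H] :
    ∃ Φ : TraceClass 𝕜 H ≃ₗᵢ[𝕜] StrongDual 𝕜 (CompactOps 𝕜 H), IsTraceDuality Φ ∧ UKKStar Φ :=
  ⟨TraceClass.traceDuality 𝕜 H, TraceClass.isTraceDuality_traceDuality,
    TraceClass.uKKStar_traceDuality⟩
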